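/- For $d\in\mathbb N$, $d\ge 1$, and bounded $A\subset\mathbb R^d$ let $A_r=\{x\in\mathbb R^d: \operatorname{dist}(x,A)\le r\}$ and $\kappa_t=\pi^{t/2}/\Gamma(1+\tfrac t2)$. For $0\le t<d$ let $$\underline{\mathcal S}^t(A)=\liminf_{r\to 0+}\frac{\mathcal H^{d-1}(\partial A_r)}{(d-t)\kappa_{d-t}\,r^{d-1-t}},\qquad \overline{\mathcal S}^t(A)=\limsup_{r\to 0+}\frac{\mathcal H^{d-1}(\partial A_r)}{(d-t)\kappa_{d-t}\,r^{d-1-t}},$$ and let $\underline{\mathcal S}^d(A)=\overline{\mathcal S}^d(A)=0$. The lower and upper S-dimension of $A$ are $$\underline{\dim}_S A=\inf\{t\in[0,d]:\underline{\mathcal S}^t(A)=0\},\qquad \overline{\dim}_S A=\inf\{t\in[0,d]:\overline{\mathcal S}^t(A)=0\}.$$ For $0<s<m<1$ put $q=1+\frac1s-\frac1m$ and let $\mathcal L(s,m)$ be the family of lengths containing, for each $k=1,2,\ldots$, the length $2^{-q^k}$ exactly $\lfloor 2^{q^{k+1}s}\rfloor$ times. A geometric realization of $\mathcal L(s,m)$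 is a union $\Omega\subset\mathbb R$ of pairwise disjoint open intervals whose lengths are the members of $\mathcal L(s,m)$ (with multiplicity), all contained in one open interval whose length is the (finite) sum $L$ of all these lengths. For such an $\Omega$ let $F(s,m)=\partial\Omega$ and $F_d(s,m)=F(s,m)\times[0,1]^{d-1}\subset\mathbb R^d$. **Statement.** Let $d\ge1$ and $0<s<u<1$. There exists a bounded set $A\subset\mathbb R^d$ with $$\underline{\dim}_S A=s+d-1\quad\text{and}\quad \overline{\dim}_S A=u+d-1 .$$ More precisely, for $m=\frac{s}{1+s-u}$ one has $s<m<1$, geometric realizations of $\mathcal L(s,m)$ exist, and for every choice of the geometric realization the set $A=F_d(s,m)$ has these two S-dimensions. -/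

import Mathlib

open Set Filter Topology MeasureTheory
open scoped ENNReal

noncomputable section

namespace SDim

/-- `κ_t = π^{t/2} / Γ(1 + t/2)`; for integers `t` the volume of the unit ball of `ℝ^t`. -/
def kappa (t : ℝ) : ℝ := Real.pi ^ (t / 2) / Real.Gamma (1 + t / 2)

/-- The surface area `H^{d-1}(∂ A_r)` of the parallel set `A_r = {x : dist(x, A) ≤ r}`
of `A ⊆ ℝ^d`.  Mathlib's Hausdorff measure `μH[n]` is built from `∑ diam^n`; the factor
`κ_n / 2^n` gives the usual normalization, for which `H^n` is Lebesgue measure on `ℝ^n`. -/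
def surfaceArea {d : ℕ} (A : Set (EuclideanSpace ℝ (Fin d))) (r : ℝ) : ℝ≥0∞ :=
  ENNReal.ofReal (kappa ((d : ℝ) - 1) / 2 ^ ((d : ℝ) - 1)) *
    Measure.hausdorffMeasure ((d : ℝ) - 1) (frontier (Metric.cthickening r A))

/-- `H^{d-1}(∂ A_r) / ((d - t) κ_{d-t} r^{d-1-t})`, used for `0 ≤ t < d` and `r > 0`, where the
denominator is positive and finite. -/
def sRatio {d : ℕ} (A : Set (EuclideanSpace ℝ (Fin d))) (t r : ℝ) : ℝ≥0∞ :=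
  surfaceArea A r /
    ENNReal.ofReal (((d : ℝ) - t) * kappa ((d : ℝ) - t) * r ^ ((d : ℝ) - 1 - t))

/-- The lower `t`-dimensional S-content of `A ⊆ ℝ^d`, `0 ≤ t ≤ d`, with the convention that it
is `0` for `t = d`. -/
def lowerSContent {d : ℕ} (t : ℝ) (A : Set (EuclideanSpace ℝ (Fin d))) : ℝ≥0∞ :=
  if t < d then liminf (fun r : ℝ => sRatio A t r) (𝓝[>] 0) else 0

/-- The upper `t`-dimensional S-content of `A ⊆ ℝ^d`, `0 ≤ t ≤ d`, with the convention that it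
is `0` for `t = d`. -/
def upperSContent {d : ℕ} (t : ℝ) (A : Set (EuclideanSpace ℝ (Fin d))) : ℝ≥0∞ :=
  if t < d then limsup (fun r : ℝ => sRatio A t r) (𝓝[>] 0) else 0

/-- The lower S-dimension. The set always contains `t = d` and is bounded below by `0`. -/
def lowerSDim {d : ℕ} (A : Set (EuclideanSpace ℝ (Fin d))) : ℝ :=
  sInf {t : ℝ | 0 ≤ t ∧ t ≤ d ∧ lowerSContent t A = 0}

/-- The upper S-dimension. The set always contains `t = d` and is bounded below by `0`. -/
def upperSDim {d : ℕ} (A : Set (EuclideanSpace ℝ (Fin d))) : ℝ :=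
  sInf {t : ℝ | 0 ≤ t ∧ t ≤ d ∧ upperSContent t A = 0}

/-- `q = 1 + 1/s - 1/m`. -/
def q (s m : ℝ) : ℝ := 1 + 1 / s - 1 / m

/-- The `k`-th length `2^{-q^k}` of the fractal string `𝓛(s, m)`, `k = 1, 2, …`. -/
def len (s m : ℝ) (k : ℕ) : ℝ := (2 : ℝ) ^ (-(q s m ^ k))

/-- The multiplicity `⌊2^{q^{k+1} s}⌋` of the `k`-th length in `𝓛(s, m)`, `k = 1, 2, …`. -/
def mult (s m : ℝ) (k : ℕ) : ℕ := ⌊(2 : ℝ) ^ (q s m ^ (k + 1) * s)⌋₊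

/-- An index set for the members of the fractal string `𝓛(s, m)`: one index for each of the
`mult s m k` copies of the length `len s m k`, where `k = 1, 2, …` (written `k + 1`, `k : ℕ`). -/
abbrev StringIndex (s m : ℝ) : Type := Σ k : ℕ, Fin (mult s m (k + 1))

/-- The fractal string `𝓛(s, m)` as an indexed family of lengths. The order of its members is
irrelevant for the geometric realizations. -/
def fractalString (s m : ℝ) (j : StringIndex s m) : ℝ := len s m (j.1 + 1)

/-- `Ω` is a geometric realization of the string of lengths `l` in an open interval whose length
is the total length `L` of the string: a union of pairwise disjoint open intervals of lengths
`l j`, all contained in an open interval of length `L = ∑ l j < ∞`. -/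
def IsGeometricRealization {ι : Type*} (l : ι → ℝ) (Ω : Set ℝ) : Prop :=
  ∃ (a : ι → ℝ) (c L : ℝ), HasSum l L ∧
    (Pairwise fun i j => Disjoint (Ioo (a i) (a i + l i)) (Ioo (a j) (a j + l j))) ∧
    (∀ j, Ioo (a j) (a j + l j) ⊆ Ioo c (c + L)) ∧
    Ω = ⋃ j, Ioo (a j) (a j + l j)

/-- The product `F × [0,1]^{d-1}` as a subset of `ℝ^d`, `d ≥ 1`. -/
def prodCube (d : ℕ) (F : Set ℝ) : Set (EuclideanSpace ℝ (Fin d)) :=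
  {x | ∀ i : Fin d, x i ∈ if i.val = 0 then F else Icc (0 : ℝ) 1}

end SDim

end

/-! Write `d = n + 1`, `F = frontier Ω` and `A = F × [0,1]^n`. The surface area of `A_r` is governed
by the number of long gaps of `F`. A gap longer than `2r` contributes a boundary point of `F_r`,
hence a unit `n`-cube in `∂A_r` (`exists_le_surfaceArea`). Conversely, squared distance to a product
splits over the coordinates, so at distance `r` some coordinate distance is at least `r/(n+1)`.
There it is affine of slope `±1`, so that coordinate is a Lipschitz function of the others. Thus
`∂A_r` is covered by Lipschitz graphs, whose number is bounded in terms of the gaps of length at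
least `2r/(n+1)` (`exists_surfaceArea_le`). Only the lengths matter, not the arrangement of the
gaps.

The choice of `m` makes `q = u/s`, so the multiplicity of the `k`-th length is about `len (k+1) ^
(-s) = len k ^ (-u)`. Hence the gap count is always at least of order `r^(-s)`, is no larger for `r`
near `len (k+1)`, reaches order `r^(-u)` for `r` near `len k`, and is `O(r^(-p))` for every `p > u`.
Comparison with `r^(n-t)` gives the dimensions `s + n` and `u + n`. -/

namespace SDim

/-! ### Parallel sets of products: Lipschitz graphs and unit cubes in the boundary. -/

/-- The squared distance to a product set is the sum of the squared coordinate distances. -/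
theorem infDist_pi_sq {ι : Type*} [Fintype ι] {F : ι → Set ℝ} (hF : ∀ i, IsClosed (F i))
    (hne : ∀ i, (F i).Nonempty) (x : EuclideanSpace ℝ ι) :
    Metric.infDist x {z : EuclideanSpace ℝ ι | ∀ i, z i ∈ F i} ^ 2
      = ∑ i, Metric.infDist (x i) (F i) ^ 2 := by
  choose p hpF hp using fun i => (hF i).exists_infDist_eq_dist (hne i) (x i)
  have hpA : WithLp.toLp 2 p ∈ {z : EuclideanSpace ℝ ι | ∀ i, z i ∈ F i} := fun i => hpF i
  apply le_antisymm
  · calc _ ≤ dist x (WithLp.toLp 2 p) ^ 2 := by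
          gcongr
          · exact Metric.infDist_nonneg
          · exact Metric.infDist_le_dist_of_mem hpA
      _ = _ := by
          rw [EuclideanSpace.dist_eq, Real.sq_sqrt (by positivity)]
          exact Finset.sum_congr rfl fun i _ => by rw [hp i]
  · have h : √(∑ i, Metric.infDist (x i) (F i) ^ 2)
        ≤ Metric.infDist x {z : EuclideanSpace ℝ ι | ∀ i, z i ∈ F i} := by
      rw [Metric.le_infDist ⟨_, hpA⟩]
      intro z hz
      rw [EuclideanSpace.dist_eq]
      gcongr with i
      · exact Metric.infDist_nonneg
      · exact Metric.infDist_le_dist_of_mem (hz i)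
    exact (Real.sqrt_le_left Metric.infDist_nonneg).1 h

/-- A bounded set that is a Lipschitz graph over a coordinate hyperplane has controlled
Hausdorff measure. -/
theorem hausdorffMeasure_le_of_graph {n : ℕ} (k : Fin (n + 1))
    {S : Set (EuclideanSpace ℝ (Fin (n + 1)))} {K : NNReal} {R : ℝ} (hR0 : 0 ≤ R)
    (hR : ∀ x ∈ S, ∀ i, |x i| ≤ R)
    (hK : ∀ x ∈ S, ∀ y ∈ S, dist x y ≤
      K * dist (fun j : Fin n => x (k.succAbove j)) (fun j : Fin n => y (k.succAbove j))) :
    Measure.hausdorffMeasure (n : ℝ) S ≤ (K : ℝ≥0∞) ^ (n : ℝ) * ENNReal.ofReal ((2 * R) ^ n) := by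
  set π : EuclideanSpace ℝ (Fin (n + 1)) → (Fin n → ℝ) := fun x j => x (k.succAbove j) with hπ
  have hinj : InjOn π S := by
    intro x hx y hy hxy
    have := hK x hx y hy
    simp only [hπ] at hxy
    rw [hxy, dist_self, mul_zero] at this
    exact dist_le_zero.1 this
  have hinv := hinj.leftInvOn_invFunOn
  have himg : Function.invFunOn π S '' (π '' S) = S := hinv.image_image
  have hlip : LipschitzOnWith K (Function.invFunOn π S) (π '' S) := by
    apply LipschitzOnWith.of_dist_le_mul
    rintro _ ⟨x, hx, rfl⟩ _ ⟨y, hy, rfl⟩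
    rw [hinv hx, hinv hy]
    exact hK x hx y hy
  have h1 := hlip.hausdorffMeasure_image_le (d := (n : ℝ)) (by positivity)
  rw [himg] at h1
  refine h1.trans ?_
  gcongr
  -- The projection lands in `Fin n → ℝ` with the sup metric, where this Hausdorff measure is
  -- exactly Lebesgue measure.
  have h2 : (Measure.hausdorffMeasure (n : ℝ) : Measure (Fin n → ℝ)) = volume := by
    simpa using hausdorffMeasure_pi_real (ι := Fin n)
  rw [h2]
  calc volume (π '' S) ≤ volume (Metric.closedBall (0 : Fin n → ℝ) R) := by
        apply measure_mono
        rintro _ ⟨x, hx, rfl⟩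
        rw [mem_closedBall_zero_iff, pi_norm_le_iff_of_nonneg hR0]
        exact fun j => hR x hx _
    _ = _ := by
        rw [Real.volume_pi_closedBall _ hR0, Fintype.card_fin]

/-- On a level set of the distance to a product, where one coordinate distance is an affine
function of slope `±1` and not too small, that coordinate is a Lipschitz function of the others. -/
theorem dist_le_of_level {n : ℕ} (k : Fin (n + 1)) {f : Fin (n + 1) → ℝ → ℝ} {r : ℝ} (hr : 0 < r)
    (hf0 : ∀ i t, 0 ≤ f i t) (hfL : ∀ i s t, |f i s - f i t| ≤ |s - t|)
    {x y : EuclideanSpace ℝ (Fin (n + 1))}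
    (hx : ∑ i, f i (x i) ^ 2 = r ^ 2) (hy : ∑ i, f i (y i) ^ 2 = r ^ 2)
    (hxk : r / (n + 1) ≤ f k (x k)) (hyk : r / (n + 1) ≤ f k (y k))
    (hxy : |x k - y k| ≤ |f k (x k) - f k (y k)|) :
    dist x y ≤ ((n + 1) ^ 3 : ℝ) *
      dist (fun j : Fin n => x (k.succAbove j)) (fun j : Fin n => y (k.succAbove j)) := by
  set D := dist (fun j : Fin n => x (k.succAbove j)) (fun j : Fin n => y (k.succAbove j)) with hD
  have hD0 : 0 ≤ D := dist_nonneg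
  have hle : ∀ (z : EuclideanSpace ℝ (Fin (n + 1))), ∑ i, f i (z i) ^ 2 = r ^ 2 →
      ∀ i, f i (z i) ≤ r := fun z hz i => by
    have := Finset.single_le_sum (f := fun i => f i (z i) ^ 2) (fun i _ => sq_nonneg _)
      (Finset.mem_univ i)
    exact abs_le_of_sq_le_sq' (by linarith) hr.le |>.2
  have hj : ∀ j : Fin n, |x (k.succAbove j) - y (k.succAbove j)| ≤ D := fun j => by
    rw [← Real.dist_eq]
    exact dist_le_pi_dist (fun j : Fin n => x (k.succAbove j))
      (fun j : Fin n => y (k.succAbove j)) j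
  -- Subtract the two level equations and factor differences of squares: each of the other `n`
  -- coordinates contributes at most `2rD`, while the factor `f k (x k) + f k (y k)` is at least
  -- `2r/(n+1)`.
  have hk : |x k - y k| ≤ (n + 1) ^ 2 * D := by
    rw [Fin.sum_univ_succAbove _ k] at hx hy
    have h1 : (f k (x k) - f k (y k)) * (f k (x k) + f k (y k))
        = ∑ j, (f (k.succAbove j) (y (k.succAbove j)) ^ 2
          - f (k.succAbove j) (x (k.succAbove j)) ^ 2) := by
      rw [Finset.sum_sub_distrib]; linarith
    have h2 : |∑ j, (f (k.succAbove j) (y (k.succAbove j)) ^ 2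
          - f (k.succAbove j) (x (k.succAbove j)) ^ 2)| ≤ ∑ _j : Fin n, 2 * r * D := by
      refine (Finset.abs_sum_le_sum_abs _ _).trans (Finset.sum_le_sum fun j _ => ?_)
      rw [sq_sub_sq, abs_mul]
      have e1 := hle x (by rw [Fin.sum_univ_succAbove _ k]; exact hx) (k.succAbove j)
      have e2 := hle y (by rw [Fin.sum_univ_succAbove _ k]; exact hy) (k.succAbove j)
      have e3 := hf0 (k.succAbove j) (x (k.succAbove j))
      have e4 := hf0 (k.succAbove j) (y (k.succAbove j))
      apply mul_le_mul _ _ (abs_nonneg _) (by positivity)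
      · rw [abs_of_nonneg (by positivity)]; linarith
      · rw [abs_sub_comm]; exact (hfL _ _ _).trans (hj j)
    rw [← h1, abs_mul, abs_of_nonneg (add_nonneg (hf0 _ _) (hf0 _ _))] at h2
    simp only [Finset.sum_const, Finset.card_univ, Fintype.card_fin, nsmul_eq_mul] at h2
    have h3 : |x k - y k| * (2 * (r / (n + 1))) ≤ n * (2 * r * D) :=
      le_trans (mul_le_mul hxy (by linarith) (by positivity) (abs_nonneg _)) h2
    have h4 : |x k - y k| * (2 * (r / (n + 1))) = (2 * r) * (|x k - y k| / (n + 1)) := by ring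
    rw [h4, show (n : ℝ) * (2 * r * D) = (2 * r) * (n * D) by ring,
      mul_le_mul_iff_right₀ (by positivity), div_le_iff₀ (by positivity)] at h3
    nlinarith
  have hall : ∀ i, |x i - y i| ≤ (n + 1) ^ 2 * D := by
    intro i
    rcases Fin.eq_self_or_eq_succAbove k i with rfl | ⟨j, rfl⟩
    · exact hk
    · refine (hj j).trans (le_mul_of_one_le_left hD0 ?_)
      have : (0 : ℝ) ≤ n := Nat.cast_nonneg n
      nlinarith
  rw [EuclideanSpace.dist_eq]
  apply Real.sqrt_le_iff.2 ⟨by positivity, _⟩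
  calc ∑ i, dist (x i) (y i) ^ 2 ≤ ∑ _i : Fin (n + 1), ((n + 1) ^ 2 * D) ^ 2 := by
        gcongr with i
        exact hall i
    _ = (n + 1) * ((n + 1) ^ 2 * D) ^ 2 := by simp
    _ ≤ (n + 1) ^ 2 * ((n + 1) ^ 2 * D) ^ 2 := by
        gcongr
        have : (0 : ℝ) ≤ n := Nat.cast_nonneg n
        nlinarith
    _ = _ := by ring

/-- If on the range `[r/(n+1), r]` each coordinate distance is one of finitely many affine
functions of slope `±1`, then the boundary of the parallel set of the product is covered by that
many Lipschitz graphs. -/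
theorem hausdorffMeasure_frontier_cthickening_le {n : ℕ} {F : Fin (n + 1) → Set ℝ}
    (hF : ∀ i, IsClosed (F i)) (hne : ∀ i, (F i).Nonempty) {R : ℝ} (hR0 : 0 ≤ R)
    (hR : ∀ i, ∀ t ∈ F i, |t| ≤ R) {r : ℝ} (hr : 0 < r) (hr1 : r ≤ 1)
    (E : Fin (n + 1) → Finset (ℝ × ℝ))
    (hE : ∀ i t, r / (n + 1) ≤ Metric.infDist t (F i) →
      ∃ e ∈ E i, |e.2| = 1 ∧ Metric.infDist t (F i) = e.2 * (t - e.1)) :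
    Measure.hausdorffMeasure (n : ℝ)
        (frontier (Metric.cthickening r {z : EuclideanSpace ℝ (Fin (n + 1)) | ∀ i, z i ∈ F i}))
      ≤ (∑ i, (E i).card : ℕ) *
        ((((n + 1) ^ 3 : NNReal) : ℝ≥0∞) ^ (n : ℝ) * ENNReal.ofReal ((2 * (R + 1)) ^ n)) := by
  set A := {z : EuclideanSpace ℝ (Fin (n + 1)) | ∀ i, z i ∈ F i} with hA
  set f : Fin (n + 1) → ℝ → ℝ := fun i t => Metric.infDist t (F i) with hf
  set B := ((((n + 1) ^ 3 : NNReal) : ℝ≥0∞) ^ (n : ℝ) * ENNReal.ofReal ((2 * (R + 1)) ^ n)) with hB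
  have hf0 : ∀ i t, 0 ≤ f i t := fun i t => Metric.infDist_nonneg
  have hfL : ∀ i s t, |f i s - f i t| ≤ |s - t| := fun i s t => by
    have := (Metric.lipschitz_infDist_pt (F i)).dist_le_mul s t
    simpa [Real.dist_eq] using this
  set S : Fin (n + 1) → ℝ × ℝ → Set (EuclideanSpace ℝ (Fin (n + 1))) := fun k e =>
    {x | ∑ i, f i (x i) ^ 2 = r ^ 2 ∧ r / (n + 1) ≤ f k (x k) ∧ |e.2| = 1 ∧
      f k (x k) = e.2 * (x k - e.1)} with hS
  have hSle : ∀ k e, Measure.hausdorffMeasure (n : ℝ) (S k e) ≤ B := by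
    intro k e
    apply hausdorffMeasure_le_of_graph k (by linarith : 0 ≤ R + 1)
    · rintro x ⟨hx, -⟩ i
      have h1 : f i (x i) ≤ r := by
        have := Finset.single_le_sum (f := fun i => f i (x i) ^ 2) (fun i _ => sq_nonneg _)
          (Finset.mem_univ i)
        exact abs_le_of_sq_le_sq' (by linarith) hr.le |>.2
      obtain ⟨p, hp, hxp⟩ := (hF i).exists_infDist_eq_dist (hne i) (x i)
      have h2 := hR i p hp
      have h3 : |x i - p| ≤ r := by rw [← Real.dist_eq, ← hxp]; exact h1
      rw [abs_le] at *
      constructor <;> linarith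
    · rintro x ⟨hx, hxk, he, hx2⟩ y ⟨hy, hyk, -, hy2⟩
      have := dist_le_of_level k hr hf0 hfL hx hy hxk hyk (by
        rw [hx2, hy2, ← mul_sub, abs_mul, he, one_mul]
        simp)
      simpa using this
  have hcov : frontier (Metric.cthickening r A) ⊆ ⋃ k, ⋃ e ∈ E k, S k e := by
    intro x hx
    have hAne : A.Nonempty := by
      choose p hp using hne
      exact ⟨WithLp.toLp 2 p, hp⟩
    have h1 : Metric.infDist x A = r := by
      have := Metric.frontier_cthickening_subset A hx
      simp only [mem_ofPred_eq] at this
      rw [Metric.infDist, this, ENNReal.toReal_ofReal hr.le]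
    have h2 : ∑ i, f i (x i) ^ 2 = r ^ 2 := by rw [← h1]; exact (infDist_pi_sq hF hne x).symm
    -- Pigeonhole; `r/√(n+1)` would be the sharp threshold, and the weaker `r/(n+1)` avoids roots.
    have h3 : ∃ k, r / (n + 1) ≤ f k (x k) := by
      by_contra! hcon
      have : ∑ i, f i (x i) ^ 2 < ∑ _i : Fin (n + 1), (r / (n + 1)) ^ 2 := by
        apply Finset.sum_lt_sum_of_nonempty Finset.univ_nonempty
        intro i _
        exact pow_lt_pow_left₀ (hcon i) (hf0 _ _) two_ne_zero
      rw [h2] at this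
      simp only [Finset.sum_const, Finset.card_univ, Fintype.card_fin, nsmul_eq_mul] at this
      have e : ((n + 1 : ℕ) : ℝ) * (r / (n + 1)) ^ 2 = r ^ 2 / (n + 1) := by
        push_cast; field_simp
      rw [e] at this
      have : r ^ 2 / ((n : ℝ) + 1) ≤ r ^ 2 := div_le_self (sq_nonneg r) (by simp)
      linarith
    obtain ⟨k, hk⟩ := h3
    obtain ⟨e, he, he1, he2⟩ := hE k (x k) hk
    simp only [mem_iUnion]
    exact ⟨k, e, he, h2, hk, he1, he2⟩
  calc _ ≤ Measure.hausdorffMeasure (n : ℝ) (⋃ k, ⋃ e ∈ E k, S k e) := measure_mono hcov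
    _ ≤ ∑ k, Measure.hausdorffMeasure (n : ℝ) (⋃ e ∈ E k, S k e) := measure_iUnion_fintype_le _ _
    _ ≤ ∑ k, ∑ e ∈ E k, Measure.hausdorffMeasure (n : ℝ) (S k e) := by
        gcongr with k
        exact measure_biUnion_finset_le _ _
    _ ≤ ∑ k, ∑ _e ∈ E k, B := by
        gcongr with k _ e
        exact hSle k e
    _ = _ := by simp [Finset.sum_mul]

/-- Over boundary points of a parallel set of `G ⊆ ℝ`, the boundary of the parallel set of
`G × [0,1]^n` contains a unit cube. -/
theorem card_le_hausdorffMeasure_frontier {n : ℕ} {G : Set ℝ} (hG : IsClosed G) (hne : G.Nonempty)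
    {r : ℝ} (hr : 0 ≤ r) (P : Finset ℝ) (hP : ∀ p ∈ P, p ∈ frontier (Metric.cthickening r G)) :
    (P.card : ℝ≥0∞) ≤ Measure.hausdorffMeasure (n : ℝ)
      (frontier (Metric.cthickening r (prodCube (n + 1) G))) := by
  have hF : ∀ i : Fin (n + 1), IsClosed (if i.val = 0 then G else Icc (0 : ℝ) 1) := fun i => by
    split_ifs
    exacts [hG, isClosed_Icc]
  have hFne : ∀ i : Fin (n + 1), (if i.val = 0 then G else Icc (0 : ℝ) 1).Nonempty := fun i => by
    split_ifs
    exacts [hne, nonempty_Icc.2 zero_le_one]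
  have hAne : (prodCube (n + 1) G).Nonempty := by
    choose p hp using hFne
    exact ⟨WithLp.toLp 2 p, hp⟩
  set emb : ℝ → (Fin n → ℝ) → EuclideanSpace ℝ (Fin (n + 1)) :=
    fun t y => WithLp.toLp 2 (Fin.cons t y) with hemb
  have hdist : ∀ t y, (∀ j, y j ∈ Icc (0 : ℝ) 1) →
      Metric.infDist (emb t y) (prodCube (n + 1) G) = Metric.infDist t G := by
    intro t y hy
    have h := infDist_pi_sq hF hFne (emb t y)
    rw [Fin.sum_univ_succ] at h
    have h0 : ∀ j : Fin n, Metric.infDist (y j) (Icc (0 : ℝ) 1) = 0 := fun j =>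
      Metric.infDist_zero_of_mem (hy j)
    simp only [hemb, Fin.cons_zero, Fin.cons_succ, Fin.val_zero, Fin.val_succ, if_true,
      Nat.succ_ne_zero, if_false, h0] at h
    simp only [ne_eq, OfNat.ofNat_ne_zero, not_false_eq_true, zero_pow, Finset.sum_const_zero,
      add_zero] at h
    exact (pow_left_inj₀ Metric.infDist_nonneg Metric.infDist_nonneg two_ne_zero).1 h
  have hmem : ∀ t y, (∀ j, y j ∈ Icc (0 : ℝ) 1) →
      (emb t y ∈ Metric.cthickening r (prodCube (n + 1) G) ↔ t ∈ Metric.cthickening r G) := by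
    intro t y hy
    rw [Metric.cthickening_eq_preimage_infEDist, Metric.cthickening_eq_preimage_infEDist,
      mem_preimage, mem_preimage, mem_Iic, mem_Iic,
      ENNReal.le_ofReal_iff_toReal_le (Metric.infEDist_ne_top hAne) hr,
      ENNReal.le_ofReal_iff_toReal_le (Metric.infEDist_ne_top hne) hr]
    have := hdist t y hy
    simp only [Metric.infDist] at this
    rw [this]
  set C : Set (Fin n → ℝ) := Icc 0 1 with hC
  have hCmem : ∀ y ∈ C, ∀ j, y j ∈ Icc (0 : ℝ) 1 := fun y hy j => ⟨hy.1 j, hy.2 j⟩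
  have hcont : Continuous fun z : ℝ × (Fin n → ℝ) => emb z.1 z.2 := by
    refine (PiLp.continuous_toLp 2 _).comp (continuous_pi fun i => ?_)
    refine Fin.cases ?_ (fun j => ?_) i
    · simpa using continuous_fst
    · simp only [Fin.cons_succ]
      fun_prop
  -- Along the slice `t ↦ emb t y` with `y` in the cube, membership in the two parallel sets agrees,
  -- so continuity carries closure points of the set and of its complement.
  have hsub : ∀ p ∈ P, emb p '' C ⊆ frontier (Metric.cthickening r (prodCube (n + 1) G)) := by
    rintro p hp _ ⟨y, hy, rfl⟩
    have hpf := hP p hp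
    rw [frontier_eq_closure_inter_closure] at hpf ⊢
    have hc : Continuous fun t => emb t y :=
      hcont.comp (by fun_prop : Continuous fun t : ℝ => (t, y))
    exact ⟨map_mem_closure (f := fun t => emb t y) hc hpf.1 fun t ht =>
        (hmem t y (hCmem y hy)).2 ht,
      map_mem_closure (f := fun t => emb t y) hc hpf.2 fun t ht h =>
        ht ((hmem t y (hCmem y hy)).1 h)⟩
  -- Dropping the first coordinate is 1-Lipschitz and maps the slice onto the unit cube.
  have hone : ∀ p, 1 ≤ Measure.hausdorffMeasure (n : ℝ) (emb p '' C) := by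
    intro p
    have h2 : (Measure.hausdorffMeasure (n : ℝ) : Measure (Fin n → ℝ)) = volume := by
      simpa using hausdorffMeasure_pi_real (ι := Fin n)
    have hlip : LipschitzWith 1
        (fun (x : EuclideanSpace ℝ (Fin (n + 1))) (j : Fin n) => x j.succ) := by
      apply LipschitzWith.of_dist_le_mul
      intro x y
      rw [NNReal.coe_one, one_mul, dist_pi_le_iff dist_nonneg]
      intro j
      rw [EuclideanSpace.dist_eq]
      apply Real.le_sqrt_of_sq_le
      exact Finset.single_le_sum (f := fun i => dist (x i) (y i) ^ 2) (fun i _ => sq_nonneg _)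
        (Finset.mem_univ j.succ)
    have h := hlip.hausdorffMeasure_image_le (d := (n : ℝ)) (by positivity) (emb p '' C)
    have himg : (fun (x : EuclideanSpace ℝ (Fin (n + 1))) (j : Fin n) => x j.succ) '' (emb p '' C)
        = C := by
      rw [image_image]
      simp [hemb]
    rw [himg, h2, hC, Real.volume_Icc_pi] at h
    simpa using h
  have hmeas : ∀ p, MeasurableSet (emb p '' C) := fun p =>
    (isCompact_Icc.image (hcont.comp (by fun_prop : Continuous fun y => (p, y)))).measurableSet
  have hdisj : (P : Set ℝ).PairwiseDisjoint fun p => emb p '' C := by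
    intro p _ p' _ hpp
    refine Set.disjoint_left.2 ?_
    rintro _ ⟨y, _, rfl⟩ ⟨y', _, h⟩
    apply hpp
    have := congrArg (fun x : EuclideanSpace ℝ (Fin (n + 1)) => x 0) h
    simpa [hemb] using this.symm
  calc (P.card : ℝ≥0∞) = ∑ _p ∈ P, 1 := by simp
    _ ≤ ∑ p ∈ P, Measure.hausdorffMeasure (n : ℝ) (emb p '' C) :=
        Finset.sum_le_sum fun p _ => hone p
    _ = Measure.hausdorffMeasure (n : ℝ) (⋃ p ∈ P, emb p '' C) :=
        (measure_biUnion_finset hdisj fun p _ => hmeas p).symm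
    _ ≤ _ := measure_mono (iUnion₂_subset hsub)

/-! ### Gaps of a geometric realization and the distance function on the line. -/

/-- The boundary of a geometric realization: it contains the endpoints of all gaps and of the
ambient interval, and its complement in that interval is exactly the union of the gaps. -/
theorem IsGeometricRealization.exists_gaps {ι : Type*} [Countable ι] [Nonempty ι] {l : ι → ℝ}
    (hl : ∀ j, 0 < l j) {Ω : Set ℝ} (h : IsGeometricRealization l Ω) :
    ∃ (a : ι → ℝ) (c e : ℝ), Function.Injective a ∧
      (∀ j, a j ∈ frontier Ω) ∧ (∀ j, a j + l j ∈ frontier Ω) ∧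
      (∀ j, ∀ t ∈ Ioo (a j) (a j + l j), t ∉ frontier Ω) ∧
      c ∈ frontier Ω ∧ e ∈ frontier Ω ∧ frontier Ω ⊆ Icc c e ∧
      ∀ t ∈ Icc c e, t ∉ frontier Ω → ∃ j, t ∈ Ioo (a j) (a j + l j) := by
  obtain ⟨a, c, L, hL, hdis, hsub, rfl⟩ := h
  set Ω := ⋃ j, Ioo (a j) (a j + l j) with hΩ
  have hLpos : 0 < L := by
    obtain ⟨j⟩ := ‹Nonempty ι›
    exact (hl j).trans_le (le_hasSum hL j fun i _ => (hl i).le)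
  have hopen : IsOpen Ω := isOpen_iUnion fun j => isOpen_Ioo
  have hΩsub : Ω ⊆ Ioo c (c + L) := iUnion_subset hsub
  have hfr : ∀ t, t ∈ frontier Ω ↔ t ∈ closure Ω ∧ t ∉ Ω := fun t => by
    rw [hopen.frontier_eq, Set.mem_sdiff]
  have hvol : volume Ω = ENNReal.ofReal L := by
    rw [hΩ, measure_iUnion hdis fun j => measurableSet_Ioo]
    simp only [Real.volume_Ioo, add_sub_cancel_left]
    rw [← hL.tsum_eq, ENNReal.ofReal_tsum_of_nonneg (fun j => (hl j).le) hL.summable]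
  -- `Ω` has the full measure `L` of the ambient interval, leaving no room for a nonempty open set
  -- outside its closure.
  have hdense : Ioo c (c + L) ⊆ closure Ω := by
    intro t ht
    by_contra hcon
    have hU : IsOpen (Ioo c (c + L) \ closure Ω) := isOpen_Ioo.sdiff isClosed_closure
    have hpos := hU.measure_pos volume ⟨t, ht, hcon⟩
    have h1 : volume Ω + volume (Ioo c (c + L) \ closure Ω) ≤ volume (Ioo c (c + L)) := by
      rw [← measure_union _ hU.measurableSet]
      · exact measure_mono (union_subset hΩsub sdiff_subset)
      · exact disjoint_left.2 fun x hx hx' => hx'.2 (subset_closure hx)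
    rw [hvol, Real.volume_Ioo, add_sub_cancel_left] at h1
    have h2 := ENNReal.lt_add_right (ENNReal.ofReal_ne_top (r := L)) hpos.ne'
    exact absurd (h2.trans_le h1) (lt_irrefl _)
  have hIcc : Icc c (c + L) ⊆ closure Ω := by
    rw [← closure_Ioo (by linarith : c ≠ c + L)]
    exact closure_minimal hdense isClosed_closure
  have hclos : closure Ω ⊆ Icc c (c + L) :=
    closure_minimal (hΩsub.trans Ioo_subset_Icc_self) isClosed_Icc
  have hcl : ∀ j, Icc (a j) (a j + l j) ⊆ closure Ω := fun j => by
    rw [← closure_Ioo (by linarith [hl j] : a j ≠ a j + l j)]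
    exact closure_mono (subset_iUnion (fun j => Ioo (a j) (a j + l j)) j)
  have hnotin : ∀ j t, t ∈ Icc (a j) (a j + l j) → t ∉ Ioo (a j) (a j + l j) → t ∉ Ω := by
    intro j t ht ht' htΩ
    obtain ⟨i, hi⟩ := mem_iUnion.1 htΩ
    have hij : i ≠ j := by rintro rfl; exact ht' hi
    have hcl' : t ∈ closure (Ioo (a j) (a j + l j)) := by
      rwa [closure_Ioo (by linarith [hl j] : a j ≠ a j + l j)]
    obtain ⟨z, hz1, hz2⟩ := mem_closure_iff.1 hcl' _ isOpen_Ioo hi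
    exact disjoint_left.1 (hdis hij) hz1 hz2
  refine ⟨a, c, c + L, ?_, fun j => ?_, fun j => ?_, fun j t ht hf => ?_, ?_, ?_, ?_, ?_⟩
  · intro i j hij
    by_contra hne
    -- Two gaps with the same left endpoint would share this point.
    have hm : a i + min (l i) (l j) / 2 ∈ Ioo (a i) (a i + l i) ∩ Ioo (a j) (a j + l j) := by
      have h0 : 0 < min (l i) (l j) := lt_min (hl i) (hl j)
      have h1 := min_le_left (l i) (l j)
      have h2 := min_le_right (l i) (l j)
      rw [← hij]
      refine ⟨⟨?_, ?_⟩, ?_, ?_⟩ <;> linarith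
    exact disjoint_left.1 (hdis hne) hm.1 hm.2
  · have hm : a j ∈ Icc (a j) (a j + l j) := ⟨le_rfl, by linarith [hl j]⟩
    exact (hfr _).2 ⟨hcl j hm, hnotin j _ hm fun h => lt_irrefl _ h.1⟩
  · have hm : a j + l j ∈ Icc (a j) (a j + l j) := ⟨by linarith [hl j], le_rfl⟩
    exact (hfr _).2 ⟨hcl j hm, hnotin j _ hm fun h => lt_irrefl _ h.2⟩
  · exact ((hfr t).1 hf).2 (mem_iUnion.2 ⟨j, ht⟩)
  · exact (hfr _).2 ⟨hIcc ⟨le_rfl, by linarith⟩, fun h => lt_irrefl _ (hΩsub h).1⟩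
  · exact (hfr _).2 ⟨hIcc ⟨by linarith, le_rfl⟩, fun h => lt_irrefl _ (hΩsub h).2⟩
  · exact fun t ht => hclos ((hfr t).1 ht).1
  · intro t ht htf
    by_contra hcon
    exact htf ((hfr t).2 ⟨hIcc ht, fun h => hcon (mem_iUnion.1 h)⟩)

/-- The distance to a closed set from a point of one of its gaps `(a, b)` is realized by an
endpoint of the gap. -/
theorem infDist_eq_of_mem_gap {G : Set ℝ} {a b t : ℝ} (ha : a ∈ G) (hb : b ∈ G)
    (hab : ∀ x ∈ Ioo a b, x ∉ G) (ht : t ∈ Ioo a b) :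
    Metric.infDist t G = min (t - a) (b - t) := by
  apply le_antisymm
  · apply le_min
    · have := Metric.infDist_le_dist_of_mem (x := t) ha
      rwa [Real.dist_eq, abs_of_pos (by linarith [ht.1])] at this
    · have := Metric.infDist_le_dist_of_mem (x := t) hb
      rwa [Real.dist_eq, abs_sub_comm, abs_of_pos (by linarith [ht.2])] at this
  · rw [Metric.le_infDist ⟨a, ha⟩]
    intro y hy
    rw [Real.dist_eq]
    rcases le_or_gt y a with h | h
    · exact (min_le_left _ _).trans (le_trans (by linarith) (le_abs_self _))
    · rcases le_or_gt b y with h' | h'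
      · exact (min_le_right _ _).trans (le_trans (by linarith) (neg_le_abs _))
      · exact absurd hy (hab y ⟨h, h'⟩)

theorem infDist_eq_of_le {G : Set ℝ} {c e t : ℝ} (hc : c ∈ G) (hG : G ⊆ Icc c e) (ht : t ≤ c) :
    Metric.infDist t G = c - t := by
  apply le_antisymm
  · have := Metric.infDist_le_dist_of_mem (x := t) hc
    rwa [Real.dist_eq, abs_sub_comm, abs_of_nonneg (by linarith)] at this
  · rw [Metric.le_infDist ⟨c, hc⟩]
    intro y hy
    rw [Real.dist_eq]
    exact le_trans (by linarith [(hG hy).1]) (neg_le_abs _)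

theorem infDist_eq_of_ge {G : Set ℝ} {c e t : ℝ} (he : e ∈ G) (hG : G ⊆ Icc c e) (ht : e ≤ t) :
    Metric.infDist t G = t - e := by
  apply le_antisymm
  · have := Metric.infDist_le_dist_of_mem (x := t) he
    rwa [Real.dist_eq, abs_of_nonneg (by linarith)] at this
  · rw [Metric.le_infDist ⟨e, he⟩]
    intro y hy
    rw [Real.dist_eq]
    exact le_trans (by linarith [(hG hy).2]) (le_abs_self _)

/-- A gap longer than `2r` contributes the point at distance `r` to the right of its left endpoint
to the boundary of the parallel set. -/
theorem mem_frontier_cthickening_of_gap {G : Set ℝ} {a b r : ℝ} (hr : 0 < r)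
    (ha : a ∈ G) (hb : b ∈ G) (hab : ∀ x ∈ Ioo a b, x ∉ G) (hlen : 2 * r < b - a) :
    a + r ∈ frontier (Metric.cthickening r G) := by
  have hmem : ∀ t, t ∈ Metric.cthickening r G ↔ Metric.infDist t G ≤ r := fun t => by
    rw [Metric.cthickening_eq_preimage_infEDist, mem_preimage, mem_Iic,
      ENNReal.le_ofReal_iff_toReal_le (Metric.infEDist_ne_top ⟨a, ha⟩) hr.le, Metric.infDist]
  rw [frontier_eq_closure_inter_closure]
  constructor
  · apply subset_closure
    rw [hmem, infDist_eq_of_mem_gap ha hb hab ⟨by linarith, by linarith⟩]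
    exact (min_le_left _ _).trans (by linarith)
  · have h1 : a + r ∈ closure (Ioo (a + r) (b - r)) := by
      rw [closure_Ioo (by linarith)]
      exact ⟨le_rfl, by linarith⟩
    refine closure_mono ?_ h1
    intro t ht
    rw [mem_compl_iff, hmem, not_le,
      infDist_eq_of_mem_gap ha hb hab ⟨by linarith [ht.1], by linarith [ht.2]⟩]
    exact lt_min (by linarith [ht.1]) (by linarith [ht.2])

/-! ### Surface area compared with gap counts. -/

theorem surfaceConst_pos (n : ℕ) : 0 < kappa n / 2 ^ (n : ℝ) := by
  unfold kappa
  have : 0 < Real.Gamma (1 + (n : ℝ) / 2) := Real.Gamma_pos_of_pos (by positivity)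
  have := Real.pi_pos
  positivity

theorem surfaceArea_eq {n : ℕ} (A : Set (EuclideanSpace ℝ (Fin (n + 1)))) (r : ℝ) :
    surfaceArea A r = ENNReal.ofReal (kappa n / 2 ^ (n : ℝ)) *
      Measure.hausdorffMeasure (n : ℝ) (frontier (Metric.cthickening r A)) := by
  have : (((n + 1 : ℕ) : ℝ) - 1) = n := by push_cast; ring
  rw [surfaceArea, this]

/-- Lower bound: the surface area is at least a constant times the number of gaps longer
than `2r`. -/
theorem IsGeometricRealization.exists_le_surfaceArea {ι : Type*} [Countable ι] [Nonempty ι]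
    {l : ι → ℝ} (hl : ∀ j, 0 < l j) {Ω : Set ℝ} (h : IsGeometricRealization l Ω) (n : ℕ) :
    ∃ C : ℝ, 0 < C ∧ ∀ r, 0 < r → ∀ T : Finset ι, (∀ j ∈ T, 2 * r < l j) →
      ENNReal.ofReal (C * T.card) ≤ surfaceArea (prodCube (n + 1) (frontier Ω)) r := by
  obtain ⟨a, c, e, hinj, ha, hb, hgap, hc, -⟩ := h.exists_gaps hl
  refine ⟨_, surfaceConst_pos n, fun r hr T hT => ?_⟩
  have hGcl : IsClosed (frontier Ω) := isClosed_frontier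
  have key := card_le_hausdorffMeasure_frontier (n := n) hGcl ⟨c, hc⟩ hr.le
    (T.map ⟨fun j => a j + r, fun i j hij => hinj (by simpa using hij)⟩) (by
      intro p hp
      obtain ⟨j, hj, rfl⟩ := Finset.mem_map.1 hp
      exact mem_frontier_cthickening_of_gap hr (ha j) (hb j) (hgap j)
        (by linarith [hT j hj]))
  rw [surfaceArea_eq, ENNReal.ofReal_mul (surfaceConst_pos n).le, ENNReal.ofReal_natCast]
  gcongr
  simpa using key

/-- Away from the set, the distance to a subset of the line with known gaps is given by finitely
many affine functions. -/
theorem exists_affine_infDist_of_gaps {ι : Type*} {G : Set ℝ} {a l : ι → ℝ} {c e : ℝ}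
    (ha : ∀ j, a j ∈ G) (hb : ∀ j, a j + l j ∈ G)
    (hgap : ∀ j, ∀ t ∈ Ioo (a j) (a j + l j), t ∉ G) (hc : c ∈ G) (he : e ∈ G) (hsub : G ⊆ Icc c e)
    (hcov : ∀ t ∈ Icc c e, t ∉ G → ∃ j, t ∈ Ioo (a j) (a j + l j)) {ρ : ℝ} (hρ : 0 < ρ)
    (T : Finset ι) (hT : ∀ j, 2 * ρ ≤ l j → j ∈ T) :
    ∃ E : Finset (ℝ × ℝ), E.card ≤ 2 * T.card + 2 ∧ ∀ t, ρ ≤ Metric.infDist t G →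
      ∃ p ∈ E, |p.2| = 1 ∧ Metric.infDist t G = p.2 * (t - p.1) := by
  classical
  -- A pair `(p, σ)` encodes `t ↦ σ(t - p)`: two pieces for each gap, one from each endpoint, and
  -- two for the rays outside `[c, e]`.
  refine ⟨T.image (fun j => (a j, (1 : ℝ))) ∪
    T.image (fun j => (a j + l j, (-1 : ℝ))) ∪ {(c, -1), (e, 1)}, ?_, fun t ht => ?_⟩
  · refine (Finset.card_union_le _ _).trans ?_
    have h1 := Finset.card_union_le (T.image (fun j => (a j, (1 : ℝ))))
      (T.image (fun j => (a j + l j, (-1 : ℝ))))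
    have h2 := Finset.card_image_le (s := T) (f := fun j => (a j, (1 : ℝ)))
    have h3 := Finset.card_image_le (s := T) (f := fun j => (a j + l j, (-1 : ℝ)))
    have h4 : ({(c, -1), (e, 1)} : Finset (ℝ × ℝ)).card ≤ 2 := Finset.card_le_two
    omega
  · rcases lt_or_ge t c with h1 | h1
    · exact ⟨(c, -1), Finset.mem_union_right _ (by simp), by simp, by
        rw [infDist_eq_of_le hc hsub h1.le]; ring⟩
    rcases lt_or_ge e t with h2 | h2
    · exact ⟨(e, 1), Finset.mem_union_right _ (by simp), by simp, by
        rw [infDist_eq_of_ge he hsub h2.le]; ring⟩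
    have h3 : t ∉ G := fun hmem => by
      rw [Metric.infDist_zero_of_mem hmem] at ht
      linarith
    obtain ⟨j, hj⟩ := hcov t ⟨h1, h2⟩ h3
    have h4 := infDist_eq_of_mem_gap (ha j) (hb j) (hgap j) hj
    have h5 := min_le_left (t - a j) (a j + l j - t)
    have h6 := min_le_right (t - a j) (a j + l j - t)
    -- Both endpoints are at distance at least `ρ`, so the gap has length at least `2ρ`.
    have hjT : j ∈ T := hT j (by linarith)
    rcases min_choice (t - a j) (a j + l j - t) with h7 | h7
    · exact ⟨(a j, 1), Finset.mem_union_left _ (Finset.mem_union_left _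
        (Finset.mem_image.2 ⟨j, hjT, rfl⟩)), by simp, by rw [h4, h7]; ring⟩
    · exact ⟨(a j + l j, -1), Finset.mem_union_left _ (Finset.mem_union_right _
        (Finset.mem_image.2 ⟨j, hjT, rfl⟩)), by simp, by rw [h4, h7]; ring⟩

/-- An interval has no gaps, so only the two outer rays contribute. -/
theorem exists_affine_infDist_Icc {ρ : ℝ} (hρ : 0 < ρ) :
    ∃ E : Finset (ℝ × ℝ), E.card ≤ 2 ∧ ∀ t, ρ ≤ Metric.infDist t (Icc (0 : ℝ) 1) →
      ∃ p ∈ E, |p.2| = 1 ∧ Metric.infDist t (Icc (0 : ℝ) 1) = p.2 * (t - p.1) := by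
  obtain ⟨E, hE, h⟩ := exists_affine_infDist_of_gaps (ι := Empty) (G := Icc (0 : ℝ) 1) (a := nofun)
    (l := nofun) (c := 0) (e := 1) nofun nofun nofun (by simp) (by simp) subset_rfl
    (fun t ht ht' => absurd ht ht') hρ ∅ nofun
  exact ⟨E, hE, h⟩

theorem coe_graphConst (n : ℕ) (x : ℝ) :
    ((((n + 1) ^ 3 : NNReal) : ℝ≥0∞) ^ (n : ℝ) * ENNReal.ofReal (x ^ n))
      = ENNReal.ofReal (((n + 1) ^ 3 : ℝ) ^ (n : ℝ) * x ^ n) := by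
  rw [ENNReal.ofReal_mul (by positivity), ← ENNReal.ofReal_rpow_of_nonneg (by positivity)
    (by positivity)]
  have : (((n + 1) ^ 3 : NNReal) : ℝ≥0∞) = ENNReal.ofReal ((n + 1) ^ 3 : ℝ) := by
    rw [← ENNReal.ofReal_coe_nnreal]
    simp
  rw [this]

/-- Upper bound: the surface area is at most a constant times one plus the number of gaps of
length at least `2r/(n+1)`. -/
theorem IsGeometricRealization.exists_surfaceArea_le {ι : Type*} [Countable ι] [Nonempty ι]
    {l : ι → ℝ} (hl : ∀ j, 0 < l j) {Ω : Set ℝ} (h : IsGeometricRealization l Ω) (n : ℕ) :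
    ∃ C : ℝ, 0 < C ∧ ∀ r, 0 < r → r ≤ 1 → ∀ T : Finset ι,
      (∀ j, 2 * (r / (n + 1)) ≤ l j → j ∈ T) →
      surfaceArea (prodCube (n + 1) (frontier Ω)) r ≤ ENNReal.ofReal (C * (T.card + 1)) := by
  classical
  obtain ⟨a, c, e, hinj, ha, hb, hgap, hc, he, hsub, hcov⟩ := h.exists_gaps hl
  have hGcl : IsClosed (frontier Ω) := isClosed_frontier
  set R : ℝ := |c| + |e| + 1 with hR
  set K : ℝ := ((n + 1) ^ 3 : ℝ) ^ (n : ℝ) * (2 * (R + 1)) ^ n with hK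
  have hK0 : 0 < K := by positivity
  clear_value K
  have hs := surfaceConst_pos n
  refine ⟨kappa n / 2 ^ (n : ℝ) * ((2 * n + 2) * K), by positivity, fun r hr hr1 T hT => ?_⟩
  have hF : ∀ i : Fin (n + 1), IsClosed (if i.val = 0 then frontier Ω else Icc (0 : ℝ) 1) :=
    fun i => by
      split_ifs
      exacts [hGcl, isClosed_Icc]
  have hFne : ∀ i : Fin (n + 1), (if i.val = 0 then frontier Ω else Icc (0 : ℝ) 1).Nonempty :=
    fun i => by
      split_ifs
      exacts [⟨c, hc⟩, nonempty_Icc.2 zero_le_one]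
  obtain ⟨E0, hE0c, hE0⟩ := exists_affine_infDist_of_gaps ha hb hgap hc he hsub hcov
    (by positivity : 0 < r / (n + 1)) T hT
  obtain ⟨E1, hE1c, hE1⟩ := exists_affine_infDist_Icc (by positivity : 0 < r / (n + 1))
  have key := hausdorffMeasure_frontier_cthickening_le (n := n) hF hFne (R := R) (by positivity)
    (by
      intro i t ht
      split_ifs at ht
      · have := hsub ht
        rw [abs_le]
        constructor
        · linarith [this.1, neg_abs_le c, abs_nonneg e]
        · linarith [this.2, le_abs_self e, abs_nonneg c]
      · rw [abs_of_nonneg ht.1]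
        linarith [ht.2, abs_nonneg c, abs_nonneg e]) hr hr1
    (fun i => if i.val = 0 then E0 else E1) (by
      intro i t ht
      split_ifs at ht ⊢ with hi
      · exact hE0 t ht
      · exact hE1 t ht)
  have hcard : ∑ i : Fin (n + 1), (if i.val = 0 then E0 else E1).card
      ≤ (2 * n + 2) * (T.card + 1) := by
    rw [Fin.sum_univ_succ]
    simp only [Fin.val_zero, if_true, Fin.val_succ, Nat.succ_ne_zero, if_false, Finset.sum_const,
      Finset.card_univ, Fintype.card_fin, smul_eq_mul]
    nlinarith [Nat.mul_le_mul_left n hE1c, Nat.zero_le (n * T.card)]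
  have hKK := coe_graphConst n (2 * (R + 1))
  rw [← hK] at hKK
  rw [hKK] at key
  rw [surfaceArea_eq, mul_assoc, ENNReal.ofReal_mul hs.le]
  gcongr
  refine key.trans ?_
  rw [← ENNReal.ofReal_natCast, ← ENNReal.ofReal_mul (Nat.cast_nonneg _)]
  apply ENNReal.ofReal_le_ofReal
  have hcard' : ((∑ i : Fin (n + 1), (if i.val = 0 then E0 else E1).card : ℕ) : ℝ)
      ≤ (2 * n + 2) * (T.card + 1) := by exact_mod_cast hcard
  linarith [mul_le_mul_of_nonneg_right hcard' hK0.le]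

/-! ### Existence of geometric realizations. -/

/-- Every countable family of positive lengths with finite sum has a geometric realization. -/
theorem exists_isGeometricRealization {ι : Type*} [Countable ι] {l : ι → ℝ} (hl : ∀ j, 0 < l j)
    (hsum : Summable l) : ∃ Ω, IsGeometricRealization l Ω := by
  classical
  obtain ⟨f, hf⟩ := exists_injective_nat ι
  -- The intervals are laid in the order of an enumeration `f`: `a j` is the total length of those
  -- preceding `j`.
  have hs : ∀ s : Set ι, Summable (s.indicator l) := fun s => hsum.indicator s
  set a : ι → ℝ := fun j => ∑' i, {i | f i < f j}.indicator l i with ha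
  have hle : ∀ j (s : Set ι), {i | f i < f j} ⊆ s → j ∈ s →
      a j + l j ≤ ∑' i, s.indicator l i := by
    intro j s hsub hjs
    have h1 : a j + l j = ∑' i, ({i | f i < f j}.indicator l i + ({j} : Set ι).indicator l i) := by
      rw [(hs _).tsum_add (hs _), ha, tsum_eq_single (f := ({j} : Set ι).indicator l) j
        (fun i hi => indicator_of_notMem (by simpa using hi) _)]
      simp
    rw [h1]
    refine Summable.tsum_le_tsum (fun i => ?_) ((hs _).add (hs _)) (hs _)
    rcases eq_or_ne i j with rfl | hij
    · simp [hjs]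
    · rw [indicator_of_notMem (s := {j}) (by simpa using hij), add_zero]
      exact indicator_le_indicator_of_subset hsub (fun i => (hl i).le) i
  have hlt : ∀ i j, f i < f j → a i + l i ≤ a j := fun i j hij =>
    hle i _ (fun k (hk : f k < f i) => show f k < f j from hk.trans hij) hij
  have ha0 : ∀ j, 0 ≤ a j := fun j => tsum_nonneg fun i => indicator_nonneg (fun i _ => (hl i).le) i
  refine ⟨_, a, 0, ∑' j, l j, hsum.hasSum, fun i j hij => ?_, fun j => ?_, rfl⟩
  · refine disjoint_left.2 ?_
    rintro x ⟨h1, h2⟩ ⟨h3, h4⟩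
    rcases lt_or_gt_of_ne (fun h => hij (hf h)) with h | h
    · linarith [hlt _ _ h]
    · linarith [hlt _ _ h]
  · rintro x ⟨h1, h2⟩
    have := hle j univ (subset_univ _) (mem_univ _)
    rw [indicator_univ] at this
    exact ⟨by linarith [ha0 j], by linarith⟩

/-! ### From power bounds on the surface area to S-dimensions. -/

theorem tendsto_rpow_nhdsGT_zero {p : ℝ} (hp : 0 < p) :
    Tendsto (fun r : ℝ => r ^ p) (𝓝[>] 0) (𝓝 0) := by
  have h := (Real.continuousAt_rpow_const 0 p (Or.inr hp.le)).tendsto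
  rw [Real.zero_rpow hp.ne'] at h
  exact h.mono_left nhdsWithin_le_nhds

theorem sRatio_eq {n : ℕ} (A : Set (EuclideanSpace ℝ (Fin (n + 1)))) (t r : ℝ) :
    sRatio A t r = surfaceArea A r /
      ENNReal.ofReal (((n : ℝ) + 1 - t) * kappa ((n : ℝ) + 1 - t) * r ^ ((n : ℝ) - t)) := by
  have : ((n + 1 : ℕ) : ℝ) - 1 - t = n - t := by push_cast; ring
  rw [sRatio, this]
  push_cast
  rfl

theorem sConst_pos {n : ℕ} {t : ℝ} (ht : t < n + 1) :
    0 < ((n : ℝ) + 1 - t) * kappa ((n : ℝ) + 1 - t) := by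
  have h : 0 < (n : ℝ) + 1 - t := by linarith
  have : 0 < Real.Gamma (1 + ((n : ℝ) + 1 - t) / 2) := Real.Gamma_pos_of_pos (by positivity)
  have := Real.pi_pos
  unfold kappa
  positivity

/-- The ratio is at least a constant times `r^(-(a+n-t))`, which blows up. The area bound stays
inside the filter statement so that it can be combined with eventual or frequent bounds; likewise in
`eventually_sRatio_le`. -/
theorem eventually_one_le_sRatio {n : ℕ} (A : Set (EuclideanSpace ℝ (Fin (n + 1)))) {t a c : ℝ}
    (ht : t < n + 1) (hta : t < a + n) (hc : 0 < c) :
    ∀ᶠ r in 𝓝[>] (0 : ℝ), ENNReal.ofReal (c * r ^ (-a)) ≤ surfaceArea A r → 1 ≤ sRatio A t r := by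
  have hK := sConst_pos ht
  set K := ((n : ℝ) + 1 - t) * kappa ((n : ℝ) + 1 - t) with hKdef
  have h := (tendsto_rpow_nhdsGT_zero (by linarith : 0 < a + n - t)).eventually
    (gt_mem_nhds (div_pos hc hK))
  filter_upwards [h, self_mem_nhdsWithin] with r hr hr0 hle
  have hr0 : 0 < r := hr0
  rw [sRatio_eq, ← hKdef, ENNReal.le_div_iff_mul_le
    (Or.inl (ENNReal.ofReal_pos.2 (by positivity)).ne') (Or.inl ENNReal.ofReal_ne_top), one_mul]
  refine le_trans (ENNReal.ofReal_le_ofReal ?_) hle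
  rw [lt_div_iff₀ hK] at hr
  calc K * r ^ ((n : ℝ) - t) = (r ^ (a + n - t) * K) * r ^ (-a) := by
        rw [show (n : ℝ) - t = (a + n - t) + -a by ring, Real.rpow_add hr0]
        ring
    _ ≤ c * r ^ (-a) := by gcongr

theorem eventually_sRatio_le {n : ℕ} (A : Set (EuclideanSpace ℝ (Fin (n + 1)))) {t a C ε : ℝ}
    (ht : t < n + 1) (hta : a + n < t) (hC : 0 < C) (hε : 0 < ε) :
    ∀ᶠ r in 𝓝[>] (0 : ℝ), surfaceArea A r ≤ ENNReal.ofReal (C * r ^ (-a)) →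
      sRatio A t r ≤ ENNReal.ofReal ε := by
  have hK := sConst_pos ht
  set K := ((n : ℝ) + 1 - t) * kappa ((n : ℝ) + 1 - t) with hKdef
  have h := (tendsto_rpow_nhdsGT_zero (by linarith : 0 < t - n - a)).eventually
    (gt_mem_nhds (div_pos (mul_pos hε hK) hC))
  filter_upwards [h, self_mem_nhdsWithin] with r hr hr0 hle
  have hr0 : 0 < r := hr0
  rw [sRatio_eq, ← hKdef, ENNReal.div_le_iff_le_mul
    (Or.inl (ENNReal.ofReal_pos.2 (by positivity)).ne') (Or.inl ENNReal.ofReal_ne_top),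
    ← ENNReal.ofReal_mul hε.le]
  refine hle.trans (ENNReal.ofReal_le_ofReal ?_)
  rw [lt_div_iff₀ hC] at hr
  calc C * r ^ (-a) = (r ^ (t - n - a) * C) * r ^ ((n : ℝ) - t) := by
        rw [show -a = (t - n - a) + ((n : ℝ) - t) by ring, Real.rpow_add hr0]
        ring
    _ ≤ (ε * K) * r ^ ((n : ℝ) - t) := by gcongr
    _ = _ := by ring

/-- No information at `t = α` is required; the convention for the content at `t = d` supplies `P N`.
-/
theorem sInf_eq_of_threshold {P : ℝ → Prop} {N α : ℝ} (hα : 0 ≤ α) (hαN : α < N) (hN : P N)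
    (hgt : ∀ t, α < t → t < N → P t) (hlt : ∀ t, t < α → ¬ P t) :
    sInf {t : ℝ | 0 ≤ t ∧ t ≤ N ∧ P t} = α := by
  have hbdd : BddBelow {t : ℝ | 0 ≤ t ∧ t ≤ N ∧ P t} := ⟨0, fun t ht => ht.1⟩
  apply le_antisymm
  · refine le_of_forall_gt_imp_ge_of_dense fun t ht => ?_
    rcases lt_or_ge t N with h | h
    · exact csInf_le hbdd ⟨hα.trans ht.le, h.le, hgt t ht h⟩
    · exact (csInf_le hbdd ⟨hα.trans hαN.le, le_rfl, hN⟩).trans h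
  · refine le_csInf ⟨N, hα.trans hαN.le, le_rfl, hN⟩ fun t ht => ?_
    by_contra! hcon
    exact hlt t hcon ht.2.2

theorem lowerSDim_eq_of_surfaceArea {n : ℕ} {A : Set (EuclideanSpace ℝ (Fin (n + 1)))} {a c C : ℝ}
    (ha : 0 ≤ a) (ha1 : a < 1) (hc : 0 < c) (hC : 0 < C)
    (hlow : ∀ᶠ r in 𝓝[>] (0 : ℝ), ENNReal.ofReal (c * r ^ (-a)) ≤ surfaceArea A r)
    (hup : ∃ᶠ r in 𝓝[>] (0 : ℝ), surfaceArea A r ≤ ENNReal.ofReal (C * r ^ (-a))) :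
    lowerSDim A = a + n := by
  have hcast : ((n + 1 : ℕ) : ℝ) = n + 1 := by push_cast; rfl
  have hn : (0 : ℝ) ≤ n := Nat.cast_nonneg n
  apply sInf_eq_of_threshold (by positivity) (by rw [hcast]; linarith)
  · simp [lowerSContent]
  · intro t ht htN
    rw [lowerSContent, if_pos htN]
    rw [hcast] at htN
    refine le_antisymm (ENNReal.le_of_forall_pos_le_add fun ε hε _ => ?_) zero_le
    rw [zero_add]
    apply Filter.liminf_le_of_frequently_le'
    have h := eventually_sRatio_le A htN ht hC (NNReal.coe_pos.2 hε)
    refine (hup.and_eventually h).mono fun r hr => ?_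
    simpa using hr.2 hr.1
  · intro t ht
    have htN : t < n + 1 := by linarith
    rw [lowerSContent, if_pos (by rwa [hcast])]
    have h : (1 : ℝ≥0∞) ≤ liminf (fun r : ℝ => sRatio A t r) (𝓝[>] 0) := by
      apply Filter.le_liminf_of_le
      · isBoundedDefault
      filter_upwards [eventually_one_le_sRatio A htN ht hc, hlow] with r h1 h2 using h1 h2
    exact (zero_lt_one.trans_le h).ne'

/-- The upper bound is asked only for exponents `p > a`, which is what a summability argument
delivers. -/
theorem upperSDim_eq_of_surfaceArea {n : ℕ} {A : Set (EuclideanSpace ℝ (Fin (n + 1)))} {a c : ℝ}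
    (ha : 0 ≤ a) (ha1 : a < 1) (hc : 0 < c)
    (hlow : ∃ᶠ r in 𝓝[>] (0 : ℝ), ENNReal.ofReal (c * r ^ (-a)) ≤ surfaceArea A r)
    (hup : ∀ p, a < p → ∃ C : ℝ, 0 < C ∧
      ∀ᶠ r in 𝓝[>] (0 : ℝ), surfaceArea A r ≤ ENNReal.ofReal (C * r ^ (-p))) :
    upperSDim A = a + n := by
  have hcast : ((n + 1 : ℕ) : ℝ) = n + 1 := by push_cast; rfl
  have hn : (0 : ℝ) ≤ n := Nat.cast_nonneg n
  apply sInf_eq_of_threshold (by positivity) (by rw [hcast]; linarith)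
  · simp [upperSContent]
  · intro t ht htN
    rw [upperSContent, if_pos htN]
    rw [hcast] at htN
    obtain ⟨p, hp1, hp2⟩ := exists_between (by linarith : a < t - n)
    obtain ⟨C, hC, hup⟩ := hup p hp1
    refine le_antisymm (ENNReal.le_of_forall_pos_le_add fun ε hε _ => ?_) zero_le
    rw [zero_add]
    apply Filter.limsup_le_of_le
    · isBoundedDefault
    filter_upwards [eventually_sRatio_le A htN (by linarith : p + n < t) hC (NNReal.coe_pos.2 hε),
      hup] with r h1 h2
    simpa using h1 h2
  · intro t ht
    have htN : t < n + 1 := by linarith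
    rw [upperSContent, if_pos (by rwa [hcast])]
    have h : (1 : ℝ≥0∞) ≤ limsup (fun r : ℝ => sRatio A t r) (𝓝[>] 0) := by
      apply Filter.le_limsup_of_frequently_le'
      exact (hlow.and_eventually (eventually_one_le_sRatio A htN ht hc)).mono fun r hr => hr.2 hr.1
    exact (zero_lt_one.trans_le h).ne'

/-! ### Lengths and multiplicities of the string. -/

theorem len_pos (s m : ℝ) (k : ℕ) : 0 < len s m k := Real.rpow_pos_of_pos two_pos _

theorem len_rpow (s m : ℝ) (k : ℕ) (p : ℝ) : len s m k ^ p = 2 ^ (-(q s m ^ k) * p) := by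
  rw [len, ← Real.rpow_mul zero_le_two]

theorem len_strictAnti {s m : ℝ} (hq : 1 < q s m) : StrictAnti (len s m) := fun i j hij => by
  apply Real.rpow_lt_rpow_of_exponent_lt one_lt_two
  exact neg_lt_neg (pow_lt_pow_right₀ hq hij)

theorem tendsto_len {s m : ℝ} (hq : 1 < q s m) : Tendsto (len s m) atTop (𝓝 0) := by
  have h1 : Tendsto (fun k : ℕ => -(q s m ^ k)) atTop atBot :=
    tendsto_neg_atTop_atBot.comp (tendsto_pow_atTop_atTop_of_one_lt hq)
  exact (tendsto_rpow_atBot_of_base_gt_one 2 one_lt_two).comp h1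

/-- The multiplicity before rounding. -/
noncomputable def realMult (s m : ℝ) (k : ℕ) : ℝ := (2 : ℝ) ^ (q s m ^ (k + 1) * s)

theorem mult_le_realMult (s m : ℝ) (k : ℕ) : (mult s m k : ℝ) ≤ realMult s m k :=
  Nat.floor_le (Real.rpow_nonneg zero_le_two _)

theorem one_le_realMult {s m : ℝ} (hs : 0 < s) (hq : 1 < q s m) (k : ℕ) : 1 ≤ realMult s m k :=
  Real.one_le_rpow one_le_two (by positivity)

theorem half_realMult_le_mult {s m : ℝ} (hs : 0 < s) (hq : 1 < q s m) (k : ℕ) :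
    realMult s m k / 2 ≤ mult s m k := by
  have h1 := one_le_realMult hs hq k
  have h2 : realMult s m k < mult s m k + 1 := Nat.lt_floor_add_one _
  have h3 : (1 : ℝ) ≤ mult s m k := by
    have : 1 ≤ mult s m k := Nat.floor_pos.2 h1
    exact_mod_cast this
  linarith

/-- The source of the two dimensions: one multiplicity is the power `-s` of the next length and, by
`len_rpow_neg`, the power `-u` of its own length. -/
theorem len_succ_rpow_neg (s m : ℝ) (k : ℕ) : len s m (k + 1) ^ (-s) = realMult s m k := by
  rw [len_rpow, realMult, neg_mul_neg]

theorem len_rpow_neg {s m u : ℝ} (hqs : q s m * s = u) (k : ℕ) :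
    len s m k ^ (-u) = realMult s m k := by
  rw [len_rpow, realMult, neg_mul_neg, ← hqs, pow_succ, mul_assoc]

/-- The multiplicities grow at least geometrically with ratio `β`, so the last term dominates the
sum. -/
theorem exists_sum_realMult_le {s m : ℝ} (hs : 0 < s) (hq : 1 < q s m) :
    ∃ C : ℝ, 0 < C ∧ ∀ k, ∑ i ∈ Finset.range (k + 1), realMult s m (i + 1)
      ≤ C * realMult s m (k + 1) := by
  set β : ℝ := 2 ^ ((q s m - 1) * s) with hβ
  have hβ1 : 1 < β := Real.one_lt_rpow one_lt_two (mul_pos (by linarith) hs)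
  have hstep : ∀ k, β * realMult s m k ≤ realMult s m (k + 1) := fun k => by
    rw [hβ, realMult, realMult, ← Real.rpow_add two_pos]
    apply Real.rpow_le_rpow_of_exponent_le one_le_two
    have h1 : 1 ≤ q s m ^ (k + 1) := one_le_pow₀ hq.le
    have h2 : 0 ≤ (q s m ^ (k + 1) - 1) * ((q s m - 1) * s) :=
      mul_nonneg (by linarith) (mul_nonneg (by linarith) hs.le)
    rw [pow_succ (q s m) (k + 1)]
    nlinarith
  refine ⟨β / (β - 1), div_pos (by linarith) (by linarith), fun k => ?_⟩
  induction k with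
  | zero =>
    have h1 := one_le_realMult hs hq 1
    have : 1 ≤ β / (β - 1) := (one_le_div (by linarith)).2 (by linarith)
    simp only [zero_add, Finset.sum_range_one]
    nlinarith
  | succ k ih =>
    rw [Finset.sum_range_succ]
    have h := hstep (k + 1)
    have hβ' : 0 < β - 1 := by linarith
    have h2 : β / (β - 1) * realMult s m (k + 1) ≤ 1 / (β - 1) * realMult s m (k + 1 + 1) := by
      rw [div_mul_eq_mul_div, div_mul_eq_mul_div, one_mul]
      gcongr
    have h3 : β / (β - 1) = 1 / (β - 1) + 1 := by field_simp; ring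
    rw [h3, add_mul, one_mul]
    rw [h3] at ih h2
    linarith

theorem fractalString_pos {s m : ℝ} (j : StringIndex s m) : 0 < fractalString s m j := len_pos _ _ _

theorem nonempty_stringIndex {s m : ℝ} (hs : 0 < s) (hq : 1 < q s m) :
    Nonempty (StringIndex s m) :=
  ⟨0, 0, Nat.floor_pos.2 (one_le_realMult hs hq 1)⟩

/-- Level `k` contributes at most `2^(-(p-u) q^(k+1))`, geometrically small by Bernoulli's
inequality. The case `p = 1` gives finite total length; general `p > u` bounds the gap counts. -/
theorem summable_fractalString_rpow {s m u p : ℝ} (hq : 1 < q s m)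
    (hqs : q s m * s = u) (hp : u < p) :
    Summable fun j : StringIndex s m => fractalString s m j ^ p := by
  rw [summable_sigma_of_nonneg fun j => Real.rpow_nonneg (fractalString_pos j).le _]
  refine ⟨fun k => Summable.of_finite, ?_⟩
  have hb : ((2 : ℝ) ^ (-((p - u) * (q s m - 1)))) < 1 :=
    Real.rpow_lt_one_of_one_lt_of_neg one_lt_two
      (neg_lt_zero.2 (mul_pos (by linarith) (by linarith)))
  refine Summable.of_nonneg_of_le (fun k => tsum_nonneg fun i =>
    Real.rpow_nonneg (fractalString_pos _).le _) (fun k => ?_)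
    (summable_geometric_of_lt_one (Real.rpow_nonneg zero_le_two _) hb)
  simp only [fractalString, tsum_fintype, Finset.sum_const, Finset.card_univ, Fintype.card_fin,
    nsmul_eq_mul]
  calc (mult s m (k + 1) : ℝ) * len s m (k + 1) ^ p
      ≤ realMult s m (k + 1) * len s m (k + 1) ^ p := by
        have := len_pos s m (k + 1)
        gcongr
        exact mult_le_realMult _ _ _
    _ = 2 ^ (-((p - u) * q s m ^ (k + 1))) := by
        rw [← len_rpow_neg hqs, ← Real.rpow_add (len_pos _ _ _), len_rpow]
        congr 1
        ring
    _ ≤ 2 ^ (-((p - u) * (q s m - 1)) * k) := by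
        apply Real.rpow_le_rpow_of_exponent_le one_le_two
        have h1 := one_add_mul_sub_le_pow (a := q s m) (by linarith) (k + 1)
        push_cast at h1
        have h2 : 0 ≤ (p - u) * (q s m ^ (k + 1) - (q s m - 1) * k) := by
          apply mul_nonneg (by linarith)
          linarith
        linarith
    _ = _ := by rw [Real.rpow_mul zero_le_two, Real.rpow_natCast]

theorem summable_fractalString {s m u : ℝ} (hq : 1 < q s m) (hqs : q s m * s = u) (hu : u < 1) :
    Summable (fractalString s m) := by
  simpa using summable_fractalString_rpow hq hqs hu

/-- The indices of all copies of the `(k+1)`-st length. -/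
noncomputable def levelIndices (s m : ℝ) (k : ℕ) : Finset (StringIndex s m) :=
  Finset.univ.map (Function.Embedding.sigmaMk k)

theorem card_levelIndices (s m : ℝ) (k : ℕ) : (levelIndices s m k).card = mult s m (k + 1) := by
  simp [levelIndices]

theorem fractalString_of_mem_levelIndices {s m : ℝ} {k : ℕ} {j : StringIndex s m}
    (hj : j ∈ levelIndices s m k) : fractalString s m j = len s m (k + 1) := by
  obtain ⟨i, -, rfl⟩ := Finset.mem_map.1 hj
  rfl

/-! ### Four estimates of the surface area by counting gaps. -/

variable {s m u : ℝ} {Ω : Set ℝ}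

/-- Place `2r` between consecutive lengths; the copies of the longer one alone number about the
shorter one to the power `-s`. -/
theorem exists_eventually_le_surfaceArea (hs : 0 < s) (hq : 1 < q s m)
    (h : IsGeometricRealization (fractalString s m) Ω) (n : ℕ) :
    ∃ c : ℝ, 0 < c ∧ ∀ᶠ r in 𝓝[>] (0 : ℝ), ENNReal.ofReal (c * r ^ (-s))
      ≤ surfaceArea (prodCube (n + 1) (frontier Ω)) r := by
  have := nonempty_stringIndex hs hq
  obtain ⟨C, hC, hlow⟩ := h.exists_le_surfaceArea fractalString_pos n
  refine ⟨C * (2 ^ (-s) / 2), by positivity, ?_⟩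
  have hsmall : ∀ᶠ r in 𝓝[>] (0 : ℝ), r < len s m 1 / 2 :=
    nhdsWithin_le_nhds (gt_mem_nhds (half_pos (len_pos s m 1)))
  filter_upwards [hsmall, self_mem_nhdsWithin] with r hr hr0
  have hr0 : 0 < r := hr0
  classical
  have hex : ∃ k, len s m (k + 1) ≤ 2 * r :=
    (((tendsto_add_atTop_iff_nat 1).2 (tendsto_len hq)).eventually
      (ge_mem_nhds (by positivity : 0 < 2 * r))).exists
  -- Since `2r < len s m 1`, the first index found is not `0` and has a predecessor.
  obtain ⟨k, hk⟩ : ∃ k, Nat.find hex = k + 1 := Nat.exists_eq_succ_of_ne_zero fun h0 => by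
    have := Nat.find_spec hex
    rw [h0] at this
    simp only [zero_add] at this
    linarith
  have h1 : len s m (k + 1 + 1) ≤ 2 * r := hk ▸ Nat.find_spec hex
  have h2 : 2 * r < len s m (k + 1) := not_le.1 (Nat.find_min hex (by omega))
  refine le_trans (ENNReal.ofReal_le_ofReal ?_) (hlow r hr0 (levelIndices s m k) fun j hj => by
    rwa [fractalString_of_mem_levelIndices hj])
  rw [card_levelIndices, mul_assoc]
  gcongr
  refine le_trans ?_ (half_realMult_le_mult hs hq (k + 1))
  rw [div_mul_eq_mul_div, ← Real.mul_rpow zero_le_two hr0.le, ← len_succ_rpow_neg]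
  gcongr 1
  exact Real.rpow_le_rpow_of_nonpos (len_pos _ _ _) h1 (by linarith)

theorem exists_frequently_le_surfaceArea (hs : 0 < s) (hq : 1 < q s m) (hqs : q s m * s = u)
    (h : IsGeometricRealization (fractalString s m) Ω) (n : ℕ) :
    ∃ c : ℝ, 0 < c ∧ ∃ᶠ r in 𝓝[>] (0 : ℝ), ENNReal.ofReal (c * r ^ (-u))
      ≤ surfaceArea (prodCube (n + 1) (frontier Ω)) r := by
  have := nonempty_stringIndex hs hq
  obtain ⟨C, hC, hlow⟩ := h.exists_le_surfaceArea fractalString_pos n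
  refine ⟨C * (4 ^ (-u) / 2), by positivity, ?_⟩
  -- At a quarter of a length, every copy of that length still strictly exceeds `2r`.
  have ht : Tendsto (fun k => len s m (k + 1) / 4) atTop (𝓝[>] 0) := by
    refine tendsto_nhdsWithin_iff.2 ⟨?_, Eventually.of_forall fun k => ?_⟩
    · simpa using ((tendsto_add_atTop_iff_nat 1).2 (tendsto_len hq)).div_const 4
    · exact div_pos (len_pos _ _ _) four_pos
  refine ht.frequently (Eventually.of_forall fun k => ?_).frequently
  have hpos := len_pos s m (k + 1)
  refine le_trans (ENNReal.ofReal_le_ofReal ?_)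
    (hlow _ (by positivity) (levelIndices s m k) fun j hj => by
      rw [fractalString_of_mem_levelIndices hj]; linarith)
  rw [card_levelIndices, mul_assoc]
  gcongr
  refine le_trans (le_of_eq ?_) (half_realMult_le_mult hs hq (k + 1))
  rw [div_mul_eq_mul_div, ← Real.mul_rpow zero_le_four (by positivity),
    mul_div_cancel₀ _ four_ne_zero, len_rpow_neg hqs]

theorem exists_frequently_surfaceArea_le (hs : 0 < s) (hq : 1 < q s m)
    (h : IsGeometricRealization (fractalString s m) Ω) (n : ℕ) :
    ∃ C : ℝ, 0 < C ∧ ∃ᶠ r in 𝓝[>] (0 : ℝ), surfaceArea (prodCube (n + 1) (frontier Ω)) r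
      ≤ ENNReal.ofReal (C * r ^ (-s)) := by
  have := nonempty_stringIndex hs hq
  obtain ⟨C, hC, hup⟩ := h.exists_surfaceArea_le fractalString_pos n
  obtain ⟨B, hB, hsum⟩ := exists_sum_realMult_le hs hq
  have hn : (0 : ℝ) < n + 1 := by positivity
  refine ⟨C * ((B + 1) * (n + 1) ^ s), by positivity, ?_⟩
  -- The factor `n + 1` turns the threshold `2r/(n+1)` into twice a length, which excludes that
  -- level and all later ones.
  have ht0 : Tendsto (fun k => (n + 1) * len s m (k + 1 + 1)) atTop (𝓝 0) := by
    simpa using ((tendsto_add_atTop_iff_nat 2).2 (tendsto_len hq)).const_mul ((n : ℝ) + 1)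
  have ht : Tendsto (fun k => (n + 1) * len s m (k + 1 + 1)) atTop (𝓝[>] 0) :=
    tendsto_nhdsWithin_iff.2 ⟨ht0, Eventually.of_forall fun k => mul_pos hn (len_pos _ _ _)⟩
  refine ht.frequently (Eventually.frequently ?_)
  filter_upwards [ht0.eventually (ge_mem_nhds one_pos)] with k hk
  have hpos := len_pos s m (k + 1 + 1)
  refine (hup _ (by positivity) hk ((Finset.range (k + 1)).sigma fun _ => Finset.univ)
    fun j hj => ?_).trans (ENNReal.ofReal_le_ofReal ?_)
  · rw [mul_div_cancel_left₀ _ hn.ne'] at hj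
    simp only [Finset.mem_sigma, Finset.mem_range, Finset.mem_univ, and_true]
    by_contra! hcon
    have := (len_strictAnti hq).antitone (show k + 1 + 1 ≤ j.1 + 1 by omega)
    rw [fractalString] at hj
    linarith
  · rw [mul_assoc]
    gcongr
    rw [Real.mul_rpow hn.le hpos.le, len_succ_rpow_neg, mul_assoc, ← mul_assoc _ (_ ^ (-s)),
      ← Real.rpow_add hn, add_neg_cancel, Real.rpow_zero, one_mul]
    have h1 := one_le_realMult hs hq (k + 1)
    have h2 : ((((Finset.range (k + 1)).sigma fun _ => Finset.univ :
        Finset (StringIndex s m)).card : ℕ) : ℝ) ≤ B * realMult s m (k + 1) := by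
      refine le_trans ?_ (hsum k)
      rw [Finset.card_sigma]
      push_cast
      simp only [Finset.card_univ, Fintype.card_fin]
      gcongr
      exact mult_le_realMult _ _ _
    linarith

/-- Chebyshev's inequality: the number of gaps of length at least `ρ` is at most `ρ^(-p)` times the
sum of the `p`-th powers. -/
theorem exists_eventually_surfaceArea_le (hs : 0 < s) (hq : 1 < q s m) (hqs : q s m * s = u)
    (h : IsGeometricRealization (fractalString s m) Ω) (n : ℕ) {p : ℝ} (hp0 : 0 ≤ p) (hp : u < p) :
    ∃ C : ℝ, 0 < C ∧ ∀ᶠ r in 𝓝[>] (0 : ℝ), surfaceArea (prodCube (n + 1) (frontier Ω)) r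
      ≤ ENNReal.ofReal (C * r ^ (-p)) := by
  have := nonempty_stringIndex hs hq
  obtain ⟨C, hC, hup⟩ := h.exists_surfaceArea_le fractalString_pos n
  have hsum := summable_fractalString_rpow hq hqs hp
  set Z := ∑' j, fractalString s m j ^ p with hZ
  have hpow : ∀ j : StringIndex s m, 0 ≤ fractalString s m j ^ p := fun j =>
    Real.rpow_nonneg (fractalString_pos j).le _
  have hZ0 : 0 ≤ Z := tsum_nonneg hpow
  have hn : (0 : ℝ) < n + 1 := by positivity
  refine ⟨C * (Z * (2 / (n + 1)) ^ (-p) + 1), by positivity, ?_⟩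
  have hsmall : ∀ᶠ r in 𝓝[>] (0 : ℝ), r < 1 := nhdsWithin_le_nhds (gt_mem_nhds one_pos)
  filter_upwards [hsmall, self_mem_nhdsWithin] with r hr hr0
  have hr0 : 0 < r := hr0
  set ρ := 2 * (r / (n + 1)) with hρ
  have hρ0 : 0 < ρ := by positivity
  have hfin : {j : StringIndex s m | ρ ≤ fractalString s m j}.Finite := by
    have h1 := hsum.tendsto_cofinite_zero.eventually (gt_mem_nhds (Real.rpow_pos_of_pos hρ0 p))
    refine (Filter.eventually_cofinite.1 h1).subset fun j hj => not_lt.2 ?_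
    exact Real.rpow_le_rpow hρ0.le hj hp0
  refine (hup r hr0 hr.le hfin.toFinset fun j hj => by simpa using hj).trans
    (ENNReal.ofReal_le_ofReal ?_)
  rw [mul_assoc]
  gcongr
  have hcard : (hfin.toFinset.card : ℝ) * ρ ^ p ≤ Z := by
    rw [← nsmul_eq_mul, ← Finset.sum_const]
    refine le_trans (Finset.sum_le_sum fun j hj => ?_) (hsum.sum_le_tsum hfin.toFinset
      fun j _ => hpow j)
    exact Real.rpow_le_rpow hρ0.le (by simpa using hj) hp0
  have h1 : (hfin.toFinset.card : ℝ) ≤ Z * ρ ^ (-p) := by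
    rw [Real.rpow_neg hρ0.le, ← div_eq_mul_inv]
    exact (le_div_iff₀ (Real.rpow_pos_of_pos hρ0 p)).2 hcard
  have h2 : ρ ^ (-p) = (2 / (n + 1)) ^ (-p) * r ^ (-p) := by
    rw [← Real.mul_rpow (by positivity) hr0.le]
    congr 1
    rw [hρ]; ring
  have h3 : 1 ≤ r ^ (-p) := Real.one_le_rpow_of_pos_of_le_one_of_nonpos hr0 hr.le (by linarith)
  rw [h2] at h1
  linarith

/-! ### Boundedness and conclusion. -/

theorem isBounded_prodCube {n : ℕ} {G : Set ℝ} (hG : Bornology.IsBounded G) :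
    Bornology.IsBounded (prodCube n G) := by
  have h : Bornology.IsBounded (Set.pi univ fun i : Fin n =>
      if i.val = 0 then G else Icc (0 : ℝ) 1) := by
    refine Bornology.IsBounded.pi fun i => ?_
    split_ifs
    exacts [hG, Metric.isBounded_Icc 0 1]
  have h2 := (EuclideanSpace.equiv (Fin n) ℝ).symm.lipschitz.isBounded_image h
  refine h2.subset fun x hx => ⟨fun i => x i, fun i _ => hx i, rfl⟩

theorem sDim_prodCube_frontier (hs : 0 < s) (hu : u < 1) (hq : 1 < q s m) (hqs : q s m * s = u)
    (h : IsGeometricRealization (fractalString s m) Ω) (n : ℕ) :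
    lowerSDim (prodCube (n + 1) (frontier Ω)) = s + n ∧
      upperSDim (prodCube (n + 1) (frontier Ω)) = u + n := by
  have hsu : s < u := by nlinarith
  obtain ⟨c, hc, h1⟩ := exists_eventually_le_surfaceArea hs hq h n
  obtain ⟨C, hC, h2⟩ := exists_frequently_surfaceArea_le hs hq h n
  obtain ⟨c', hc', h3⟩ := exists_frequently_le_surfaceArea hs hq hqs h n
  exact ⟨lowerSDim_eq_of_surfaceArea hs.le (hsu.trans hu) hc hC h1 h2,
    upperSDim_eq_of_surfaceArea (hs.trans hsu).le hu hc' h3 fun p hp =>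
      exists_eventually_surfaceArea_le hs hq hqs h n ((hs.trans hsu).trans hp).le hp⟩

theorem isBounded_frontier_of_isGeometricRealization (hs : 0 < s) (hq : 1 < q s m)
    (h : IsGeometricRealization (fractalString s m) Ω) : Bornology.IsBounded (frontier Ω) := by
  have := nonempty_stringIndex hs hq
  obtain ⟨_, c, e, -, -, -, -, -, -, hsub, -⟩ := h.exists_gaps fractalString_pos
  exact (Metric.isBounded_Icc c e).subset hsub

end SDim

theorem mainTheorem4 (d : ℕ) (hd : 1 ≤ d) (s u : ℝ) (hs : 0 < s) (hsu : s < u) (hu : u < 1) :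
    (∃ A : Set (EuclideanSpace ℝ (Fin d)),
      Bornology.IsBounded A ∧
      SDim.lowerSDim A = s + d - 1 ∧ SDim.upperSDim A = u + d - 1) ∧
    (∀ m : ℝ, m = s / (1 + s - u) →
      s < m ∧ m < 1 ∧
      (∃ Ω : Set ℝ, SDim.IsGeometricRealization (SDim.fractalString s m) Ω) ∧
      (∀ Ω : Set ℝ, SDim.IsGeometricRealization (SDim.fractalString s m) Ω →
        SDim.lowerSDim (SDim.prodCube d (frontier Ω)) = s + d - 1 ∧
        SDim.upperSDim (SDim.prodCube d (frontier Ω)) = u + d - 1)) := by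
  obtain ⟨n, rfl⟩ := Nat.exists_eq_add_of_le' hd
  have hcast : ∀ x : ℝ, x + ((n + 1 : ℕ) : ℝ) - 1 = x + n := fun x => by push_cast; ring
  simp only [hcast]
  have hpos : 0 < 1 + s - u := by linarith
  -- This identity is what fixes the choice of `m`: it makes `q = u/s`.
  have hqs : SDim.q s (s / (1 + s - u)) * s = u := by
    rw [SDim.q]
    field_simp
    ring
  have hq : 1 < SDim.q s (s / (1 + s - u)) := by
    by_contra! hcon
    nlinarith
  obtain ⟨Ω, hΩ⟩ := SDim.exists_isGeometricRealization SDim.fractalString_pos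
    (SDim.summable_fractalString hq hqs hu)
  refine ⟨⟨SDim.prodCube (n + 1) (frontier Ω), SDim.isBounded_prodCube
    (SDim.isBounded_frontier_of_isGeometricRealization hs hq hΩ),
    SDim.sDim_prodCube_frontier hs hu hq hqs hΩ n⟩, ?_⟩
  rintro m rfl
  refine ⟨?_, ?_, ⟨Ω, hΩ⟩, fun Ω' hΩ' => SDim.sDim_prodCube_frontier hs hu hq hqs hΩ' n⟩
  · rw [lt_div_iff₀ hpos]
    nlinarith
  · rw [div_lt_one hpos]
    linarith
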